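/- Let $L$ be an odd prime. Then there is an elliptic curve $E$ over $\mathbb{Q}$ with full $2$-torsion (that is, $E(\mathbb{Q})[2]\cong(\mathbb{Z}/2\mathbb{Z})^2$) and conductor $2L$ if and only if $L\ge 31$ and $L$ is a Mersenne prime or a Fermat prime (that is, $L=2^n-1$ or $L=2^{2^n}+1$ for some integer $n\ge 0$). -/

import Mathlib

open scoped NumberField

namespace WeierstrassCurve

noncomputable section

/-- `E` has full `2`-torsion over `ℚ`: the group `E(ℚ)[2]` is isomorphic to `(ℤ/2ℤ)²`. -/
def HasFullTwoTorsion (W : WeierstrassCurve ℚ) : Prop :=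
  Nonempty (AddSubgroup.torsionBy W.toAffine.Point 2 ≃+ ZMod 2 × ZMod 2)

open Classical in
/-- The `ℓ`-division field `ℚ(E[ℓ])`: the subfield of the algebraic closure of `ℚ` generated by
the coordinates of all affine points `(x, y)` of `E` over the algebraic closure with
`ℓ • (x, y) = 0`. -/
def divisionField (W : WeierstrassCurve ℚ) (ℓ : ℕ) :
    IntermediateField ℚ (AlgebraicClosure ℚ) :=
  IntermediateField.adjoin ℚ
    {t | ∃ (x y : AlgebraicClosure ℚ)
        (h : (W.baseChange (AlgebraicClosure ℚ)).toAffine.Nonsingular x y),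
      ℓ • (Affine.Point.some x y h) = 0 ∧ (t = x ∨ t = y)}

section Ramification

variable (F : Type*) [Field F] [Algebra ℚ F]

/-- The `i`-th ramification group (in the lower numbering) of `F/ℚ` at a prime `𝔓` of `𝓞 F`: all
automorphisms `σ` of `F` with `σ x ≡ x` modulo `𝔓 ^ (i + 1)` for every `x` in `𝓞 F`. For `i = 0`
this is the inertia group of `𝔓`. -/
def ramificationGroup (𝔓 : Ideal (𝓞 F)) (i : ℕ) : Subgroup (F ≃ₐ[ℚ] F) :=
  (𝔓 ^ (i + 1)).inertia (F ≃ₐ[ℚ] F)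

variable [DecidableEq F]

/-- The group `E(F)[ℓ]` of `F`-rational `ℓ`-torsion points. -/
abbrev torsionPoints (W : WeierstrassCurve ℚ) (ℓ : ℕ) :
    AddSubgroup (W.baseChange F).toAffine.Point :=
  AddSubgroup.torsionBy (W.baseChange F).toAffine.Point (ℓ : ℤ)

instance (W : WeierstrassCurve ℚ) (ℓ : ℕ) : Module (ZMod ℓ) (W.torsionPoints F ℓ) :=
  AddSubgroup.torsionBy.zmodModule

/-- The subgroup of the points of `E(F)[ℓ]` that are fixed by a group `H` of automorphisms of `F`,
which act on the coordinates of points. -/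
def fixedTorsionPoints (W : WeierstrassCurve ℚ) (ℓ : ℕ) (H : Subgroup (F ≃ₐ[ℚ] F)) :
    AddSubgroup (W.torsionPoints F ℓ) where
  carrier := {P | ∀ σ ∈ H, Affine.Point.map (W' := W) (σ : F →ₐ[ℚ] F) P.1 = P.1}
  zero_mem' _ _ := map_zero _
  add_mem' hP hQ σ hσ := by
    rw [AddSubgroup.coe_add, map_add, hP σ hσ, hQ σ hσ]
  neg_mem' hP σ hσ := by
    rw [AddSubgroup.coe_neg, map_neg, hP σ hσ]

/-- The sum `∑_{i ≥ 1} (|G_i| / |G_0|) · dim (E(F)[ℓ] / E(F)[ℓ]^{G_i})`, where `G_i` are the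
ramification groups of `F/ℚ` at `𝔓` and dimensions are taken over `ℤ/ℓℤ`. It is applied to the
division field `F = ℚ(E[ℓ])`, a finite Galois extension of `ℚ` with `E(F)[ℓ] = E[ℓ]`, and to a
nonzero prime `𝔓`; then `G_i` is trivial for large `i` and the sum is finite. -/
def wildSum (W : WeierstrassCurve ℚ) (ℓ : ℕ) (𝔓 : Ideal (𝓞 F)) : ℚ :=
  ∑ᶠ i : ℕ,
    (Nat.card (ramificationGroup F 𝔓 (i + 1)) : ℚ) / (Nat.card (ramificationGroup F 𝔓 0) : ℚ) *
      (Module.finrank (ZMod ℓ) (W.torsionPoints F ℓ ⧸ AddSubgroup.toZModSubmodule ℓ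
        (W.fixedTorsionPoints F ℓ (ramificationGroup F 𝔓 (i + 1)))) : ℚ)

end Ramification

/-- Some prime ideal of the ring of integers of an extension `F` of `ℚ` above a prime `p`. -/
def primeAbove (F : Type*) [Field F] [Algebra ℚ F] (p : ℕ) [hp : Fact p.Prime] : Ideal (𝓞 F) :=
  haveI : CharZero F := algebraRat.charZero F
  haveI : (Ideal.span {(p : ℤ)}).IsPrime :=
    (Ideal.span_singleton_prime (Nat.cast_ne_zero.mpr hp.out.ne_zero)).mpr
      (Nat.prime_iff_prime_int.mp hp.out)
  (Classical.choice (Ideal.nonempty_primesOver (S := 𝓞 F) (Ideal.span {(p : ℤ)}))).1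

open Classical in
/-- The wild part `δ_p` of the conductor exponent at `p`, computed from the action of the higher
ramification groups on `E[ℓ]` for a prime `ℓ ≠ p`. It depends neither on `ℓ` nor on the prime
above `p` in the division field; here `ℓ = 3` if `p = 2` and `ℓ = 2` otherwise. -/
def wildConductorExponent (W : WeierstrassCurve ℚ) (p : ℕ) [Fact p.Prime] : ℚ :=
  let ℓ : ℕ := if p = 2 then 3 else 2
  W.wildSum (W.divisionField ℓ) ℓ (primeAbove (W.divisionField ℓ) p)

open Classical in
/-- The exponent `f_p` of the conductor at `p`: it is `0` if `E` has good reduction at `p`, `1` if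
the reduction is multiplicative, and `2 + δ_p` if it is additive, where the type of the reduction
is that of a minimal Weierstrass equation over `ℚ_p`. -/
def conductorExponent (W : WeierstrassCurve ℚ) (p : ℕ) [Fact p.Prime] : ℚ :=
  let Wmin : WeierstrassCurve ℚ_[p] := (W.baseChange ℚ_[p]).minimal ℤ_[p]
  if Wmin.HasGoodReduction ℤ_[p] then 0
  else if Wmin.HasMultiplicativeReduction ℤ_[p] then 1
  else 2 + W.wildConductorExponent p

/-- The positive integer `N` is the conductor `∏_p p ^ f_p` of `E`: for every prime `p`, the
exponent of `p` in `N` is `f_p`. -/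
def IsConductor (W : WeierstrassCurve ℚ) (N : ℕ) : Prop :=
  0 < N ∧ ∀ (p : ℕ) [Fact p.Prime], (padicValNat p N : ℚ) = W.conductorExponent p

end

end WeierstrassCurve

/-! Full 2-torsion means that the 2-division cubic has three rational roots. Up to a scalar their
differences are coprime integers `a`, `b`, `a + b`. With `P = ab(a + b)` and `N = a² + ab + b²`, the
invariants are `c₄ = 16 l² N` and `Δ = 16 l⁶ P²`, so integrality of `j = 256 N³ / P²` at a prime
does not depend on `l`.

Conductor `2L` makes `j` integral away from `2L` and non-integral at `2` and `L`. As `N` and `P` are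
coprime, `P` is supported on `{2, L}` and divisible by `L`; the factor `256` forces `32 ∣ P`
(`exists_two_pow_of_isConductor`). The coprime relation `a + b = (a + b)` then reads `L ^ m = 2 ^ k
± 1` with `k ≥ 5`, and elementary cases of Catalan's equation give `m = 1`.

Conversely, for `L = 2 ^ k ± 1` the explicit family `twoTorsionFamily`, at `s` equal to plus or
minus a power of two, has discriminant supported on `{2, L}` and multiplicative reduction at both
(`twoTorsionFamily_isConductor`). -/

/-! ### Prime powers next to powers of two -/

/-- The cofactor `1 + x + ⋯ + x ^ (m - 1)` is a sum of `m` odd terms, hence odd; dividing a power of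
two, it is `±1`. -/
theorem Int.pow_sub_one_eq_of_dvd_two_pow {x : ℤ} {m k : ℕ} (hx : Odd x) (hm : Odd m)
    (h : x ^ m - 1 ∣ 2 ^ k) : x ^ m - 1 = x - 1 ∨ x ^ m - 1 = -(x - 1) := by
  have hS : Odd (∑ i ∈ Finset.range m, x ^ i) := by
    have hx0 : (x : ZMod 2) = 1 := by
      obtain ⟨y, rfl⟩ := hx
      push_cast
      rw [show (2 : ZMod 2) = 0 from rfl]
      ring
    rw [← ZMod.intCast_eq_one_iff_odd]
    simpa [hx0] using (ZMod.natCast_eq_one_iff_odd).2 hm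
  have hmul := geom_sum_mul x m
  have hunit : IsUnit (∑ i ∈ Finset.range m, x ^ i) :=
    (Int.isCoprime_iff_gcd_eq_one.2 (by simpa [Int.gcd_comm] using
      (Int.isCoprime_iff_gcd_eq_one.1 (IsCoprime.pow_right (n := k)
        (Int.isCoprime_two_right.2 hS))))).isUnit_of_dvd'
      dvd_rfl (((Dvd.intro _ hmul).trans h))
  rcases Int.isUnit_iff.1 hunit with h1 | h1 <;> rw [h1] at hmul
  · left; linarith
  · right; linarith

theorem Nat.eq_one_of_pow_add_one_eq_two_pow {L m k : ℕ} (hL : 2 ≤ L) (hk : 2 ≤ k)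
    (h : L ^ m + 1 = 2 ^ k) : m = 1 := by
  have h4 : 4 ∣ L ^ m + 1 := h ▸ pow_dvd_pow 2 hk
  have hm : Odd m := by
    -- For even `m` the power is a square, so `L ^ m + 1` is `1` or `2` modulo `4`.
    by_contra hm
    obtain ⟨n, rfl⟩ := Nat.not_odd_iff_even.1 hm
    rw [pow_add] at h4
    have h5 : L ^ n % 4 = 0 ∨ L ^ n % 4 = 1 ∨ L ^ n % 4 = 2 ∨ L ^ n % 4 = 3 := by omega
    rcases h5 with h5 | h5 | h5 | h5 <;>
      simp [Nat.dvd_iff_mod_eq_zero, Nat.add_mod, Nat.mul_mod, h5] at h4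
  have hodd : Odd L := by
    by_contra hL'
    have : Even (L ^ m) := (Nat.not_odd_iff_even.1 hL').pow_of_ne_zero hm.pos.ne'
    grind
  have hz : ((L : ℤ) ^ m + 1) = 2 ^ k := by exact_mod_cast h
  have hLz : (2 : ℤ) ≤ L := by exact_mod_cast hL
  have hpos : (0 : ℤ) < (L : ℤ) ^ m := by positivity
  rcases Int.pow_sub_one_eq_of_dvd_two_pow (x := -L) (k := k) (m := m)
    (by simpa using hodd) hm (by rw [hm.neg_pow, ← hz]; exact ⟨-1, by ring⟩) with h1 | h1 <;>
    rw [hm.neg_pow] at h1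
  · have : L ^ m = L ^ 1 := by zify; linarith
    exact Nat.pow_right_injective hL this
  · linarith

/-- The bound on `k` excludes `3 ^ 2 = 2 ^ 3 + 1`. -/
theorem Nat.eq_one_of_pow_eq_two_pow_add_one {L m k : ℕ} (hk : 4 ≤ k)
    (h : L ^ m = 2 ^ k + 1) : m = 1 := by
  have hk0 : 16 ≤ 2 ^ k := Nat.pow_le_pow_right (n := 2) (by norm_num) hk
  have hL : 2 ≤ L := by
    by_contra hL
    have : L ^ m ≤ 1 := by
      calc L ^ m ≤ 1 ^ m := Nat.pow_le_pow_left (by omega) m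
        _ = 1 := one_pow m
    omega
  have hm : Odd m := by
    by_contra hm
    obtain ⟨n, rfl⟩ := Nat.not_odd_iff_even.1 hm
    rw [pow_add] at h
    generalize L ^ n = q at h
    obtain ⟨r, rfl⟩ : ∃ r, q = r + 1 := ⟨q - 1, by
      have : q ≠ 0 := by rintro rfl; omega
      omega⟩
    -- Two powers of two that differ by `2` are `2` and `4`, with product `8 < 2 ^ k`.
    have h1 : r * (r + 2) = 2 ^ k := by linarith
    have hr : r ≠ 0 := by
      rintro rfl
      omega
    obtain ⟨a, -, ha⟩ := (Nat.dvd_prime_pow Nat.prime_two).1 (Dvd.intro _ h1)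
    obtain ⟨b, -, hb⟩ := (Nat.dvd_prime_pow Nat.prime_two).1 (Dvd.intro_left _ h1)
    rcases Nat.lt_or_ge a 2 with h2 | h2
    · interval_cases a <;> norm_num at ha <;> subst ha <;> omega
    · have h3 : 4 ∣ r := ha ▸ pow_dvd_pow 2 h2
      rcases Nat.lt_or_ge b 2 with h4 | h4
      · interval_cases b <;> omega
      · have h5 : 4 ∣ r + 2 := hb ▸ pow_dvd_pow 2 h4
        omega
  have hodd : Odd L := by
    by_contra hL'
    have : Even (L ^ m) := (Nat.not_odd_iff_even.1 hL').pow_of_ne_zero hm.pos.ne'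
    have : Even (2 ^ k) := even_two.pow_of_ne_zero (by omega)
    grind
  have hz : ((L : ℤ) ^ m) = 2 ^ k + 1 := by exact_mod_cast h
  have hLz : (2 : ℤ) ≤ L := by exact_mod_cast hL
  have hpos : (2 : ℤ) ≤ (L : ℤ) ^ m := by rw [hz]; zify at hk0; linarith
  rcases Int.pow_sub_one_eq_of_dvd_two_pow (x := L) (k := k) (m := m)
    (by simpa using hodd) hm (by rw [hz]; exact ⟨1, by ring⟩) with h1 | h1
  · have : L ^ m = L ^ 1 := by zify; linarith
    exact Nat.pow_right_injective hL this
  · linarith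

theorem Int.exists_natAbs_eq_prime_pow {n : ℤ} {p : ℕ} (hn : n ≠ 0)
    (h : ∀ q : ℕ, q.Prime → (q : ℤ) ∣ n → q = p) : ∃ m, n.natAbs = p ^ m :=
  ⟨_, Nat.eq_prime_pow_of_unique_prime_dvd (Int.natAbs_ne_zero.2 hn)
    fun hq hd ↦ h _ hq (Int.natCast_dvd.2 hd)⟩

/-- The solutions of `a + b + c = 0` in coprime integers supported on `{2, L}`, where `32 ∣ b`. -/
theorem Int.exists_two_pow_of_add_eq_zero {L : ℕ} (hL : L.Prime) (hL2 : L ≠ 2) {a b c : ℤ}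
    (habc : a + b + c = 0) (hab : IsCoprime a b) (hac : IsCoprime a c) (hbc : IsCoprime b c)
    (h0 : a * b * c ≠ 0) (hp : ∀ q : ℕ, q.Prime → (q : ℤ) ∣ a * b * c → q = 2 ∨ q = L)
    (hLd : (L : ℤ) ∣ a * b * c) (h32 : 32 ∣ b) :
    ∃ k, 5 ≤ k ∧ (L + 1 = 2 ^ k ∨ L = 2 ^ k + 1) := by
  obtain ⟨⟨ha0, hb0⟩, hc0⟩ : (a ≠ 0 ∧ b ≠ 0) ∧ c ≠ 0 := by simpa [mul_eq_zero, not_or] using h0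
  have hdisj : ∀ {u v : ℤ} {q : ℕ}, q.Prime → IsCoprime u v → (q : ℤ) ∣ u → ¬ (q : ℤ) ∣ v :=
    fun hq huv hu hv ↦ (Nat.prime_iff_prime_int.1 hq).not_isUnit (huv.isUnit_of_dvd' hu hv)
  have h2b : ((2 : ℕ) : ℤ) ∣ b := (by norm_num : ((2 : ℕ) : ℤ) ∣ 32).trans h32
  have h2a : ¬ ((2 : ℕ) : ℤ) ∣ a := hdisj Nat.prime_two hab.symm h2b
  have h2c : ¬ ((2 : ℕ) : ℤ) ∣ c := hdisj Nat.prime_two hbc h2b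
  have ha : ∀ q : ℕ, q.Prime → (q : ℤ) ∣ a → q = L := fun q hq hd ↦
    (hp q hq ((hd.mul_right b).mul_right c)).resolve_left (by rintro rfl; exact h2a hd)
  have hc : ∀ q : ℕ, q.Prime → (q : ℤ) ∣ c → q = L := fun q hq hd ↦
    (hp q hq (hd.mul_left _)).resolve_left (by rintro rfl; exact h2c hd)
  have hone : ∀ {u : ℤ}, ¬ (L : ℤ) ∣ u → (∀ q : ℕ, q.Prime → (q : ℤ) ∣ u → q = L) →
      u.natAbs = 1 := by
    intro u hu h
    by_contra h1
    obtain ⟨q, hq, hd⟩ := Nat.exists_prime_and_dvd h1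
    have hd := Int.natCast_dvd.2 hd
    exact hu (h q hq hd ▸ hd)
  have hLp := Nat.prime_iff_prime_int.1 hL
  -- If `L ∣ b`, then `a` and `c` are units, so `|b| ≤ 2`, against `32 ∣ b` and `b ≠ 0`.
  by_cases hLb : (L : ℤ) ∣ b
  · have h1 := hone (hdisj hL hab.symm hLb) ha
    have h2 := hone (hdisj hL hbc hLb) hc
    omega
  obtain ⟨k, hk⟩ := Int.exists_natAbs_eq_prime_pow (n := b) (p := 2) hb0 fun q hq hd ↦
    (hp q hq ((hd.mul_left a).mul_right c)).resolve_right (by rintro rfl; exact hLb hd)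
  have hk5 : 5 ≤ k := by
    have : 2 ^ 5 ∣ 2 ^ k := by rw [← hk]; exact Int.natCast_dvd.1 h32
    exact (Nat.pow_dvd_pow_iff_le_right (by norm_num)).1 this
  have key : ∀ m, (L ^ m + 1 = 2 ^ k ∨ L ^ m = 2 ^ k + 1) → L + 1 = 2 ^ k ∨ L = 2 ^ k + 1 := by
    rintro m (h | h)
    · rw [Nat.eq_one_of_pow_add_one_eq_two_pow hL.two_le (by omega) h] at h
      simpa using Or.inl h
    · rw [Nat.eq_one_of_pow_eq_two_pow_add_one (by omega) h] at h
      simpa using Or.inr h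
  refine ⟨k, hk5, ?_⟩
  have hk32 : 32 ≤ 2 ^ k := Nat.pow_le_pow_right (n := 2) (by norm_num) hk5
  by_cases hLa : (L : ℤ) ∣ a
  · obtain ⟨m, hm⟩ := Int.exists_natAbs_eq_prime_pow ha0 ha
    have h1 := hone (hdisj hL hac hLa) hc
    exact key m (by omega)
  · obtain ⟨m, hm⟩ := Int.exists_natAbs_eq_prime_pow hc0 hc
    have h1 := hone hLa ha
    exact key m (by omega)

/-- Exactly one of `a`, `b`, `a + b` is even. Being coprime to the other two, it absorbs the whole
factor `32` and plays the role of `b` in the symmetric version. -/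
theorem Int.exists_two_pow_of_isCoprime {L : ℕ} (hL : L.Prime) (hL2 : L ≠ 2) {a b : ℤ}
    (hab : IsCoprime a b) (h0 : a * b * (a + b) ≠ 0)
    (hp : ∀ q : ℕ, q.Prime → (q : ℤ) ∣ a * b * (a + b) → q = 2 ∨ q = L)
    (hLd : (L : ℤ) ∣ a * b * (a + b)) (h32 : 32 ∣ a * b * (a + b)) :
    ∃ k, 5 ≤ k ∧ (L + 1 = 2 ^ k ∨ L = 2 ^ k + 1) := by
  have hac : IsCoprime a (-(a + b)) := by
    obtain ⟨u, v, h⟩ := hab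
    exact ⟨u - v, -v, by linear_combination h⟩
  have hbc : IsCoprime b (-(a + b)) := by
    obtain ⟨u, v, h⟩ := hab
    exact ⟨v - u, -u, by linear_combination h⟩
  have hdvd : ∀ {n : ℤ}, n ∣ a * b * (a + b) → n ∣ a * b * -(a + b) := fun h ↦ by
    rwa [mul_neg, dvd_neg]
  have hp' : ∀ q : ℕ, q.Prime → (q : ℤ) ∣ a * b * -(a + b) → q = 2 ∨ q = L := fun q hq h ↦
    hp q hq (by rwa [mul_neg, dvd_neg] at h)
  have h0' : a * b * -(a + b) ≠ 0 := by rwa [mul_neg, neg_ne_zero]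
  have hodd : ∀ {x y : ℤ}, IsCoprime x y → 2 ∣ x → IsCoprime 32 y := by
    intro x y hxy hx
    have : IsCoprime (2 ^ 5) y := (hxy.of_isCoprime_of_dvd_left hx).pow_left
    simpa using this
  by_cases hb : 2 ∣ b
  · refine exists_two_pow_of_add_eq_zero hL hL2 (a := a) (b := b) (c := -(a + b)) (by ring)
      hab hac hbc h0' hp' (hdvd hLd) ?_
    have h1 := (hodd hbc hb).dvd_of_dvd_mul_right (hdvd h32)
    exact (hodd hab.symm hb).dvd_of_dvd_mul_left h1
  by_cases ha : 2 ∣ a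
  · refine exists_two_pow_of_add_eq_zero hL hL2 (a := b) (b := a) (c := -(a + b)) (by ring)
      hab.symm hbc hac (by rwa [mul_comm b]) (by rwa [mul_comm b])
      (by rw [mul_comm b]; exact hdvd hLd) ?_
    have h1 := (hodd hac ha).dvd_of_dvd_mul_right (hdvd h32)
    exact (hodd hab ha).dvd_of_dvd_mul_right h1
  · have hc : 2 ∣ -(a + b) := by omega
    have e : a * -(a + b) * b = a * b * -(a + b) := by ring
    refine exists_two_pow_of_add_eq_zero hL hL2 (a := a) (b := -(a + b)) (c := b) (by ring)
      hac hab hbc.symm (by rwa [e]) (by rwa [e]) (by rw [e]; exact hdvd hLd) ?_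
    have h1 := (hodd hbc.symm hc).dvd_of_dvd_mul_right (by rw [e]; exact hdvd h32)
    exact (hodd hac.symm hc).dvd_of_dvd_mul_left h1

/-! ### Reduction types over a discrete valuation ring -/

namespace WeierstrassCurve

section Reduction

open IsDiscreteValuationRing IsDedekindDomain.HeightOneSpectrum

variable (R : Type*) [CommRing R] [IsDomain R] [IsDiscreteValuationRing R]
variable {K : Type*} [Field K] [Algebra R K] [IsFractionRing R K]

lemma valuation_c₄_le_one (W : WeierstrassCurve K) [IsIntegral R W] :
    valuation K (maximalIdeal R) W.c₄ ≤ 1 := by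
  rw [← integralModel_c₄_eq R W]
  exact valuation_le_one _ _

lemma valuation_Δ_le_one (W : WeierstrassCurve K) [IsIntegral R W] :
    valuation K (maximalIdeal R) W.Δ ≤ 1 := by
  rw [← integralModel_Δ_eq R W]
  exact valuation_le_one _ _

lemma exists_minimal_eq_smul (W : WeierstrassCurve K) :
    ∃ C : VariableChange K, W.minimal R = C • W :=
  ⟨_, rfl⟩

lemma valuation_Δ_le_minimal (W : WeierstrassCurve K) [IsIntegral R W] :
    valuation K (maximalIdeal R) W.Δ ≤ valuation K (maximalIdeal R) (W.minimal R).Δ := by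
  obtain ⟨C, hC⟩ := W.exists_minimal_eq_smul R
  have hmin : IsMinimal R (W.minimal R) := inferInstance
  have hW : C⁻¹ • W.minimal R = W := by rw [hC, inv_smul_smul]
  have h := hmin.val_Δ_maximal
  have h2 : valuation_Δ_aux R W ≤ valuation_Δ_aux R (W.minimal R) := by
    rcases le_total (valuation_Δ_aux R W) (valuation_Δ_aux R (W.minimal R)) with h' | h'
    · exact h'
    · have := h.2 (j := C⁻¹) (by simp only [hW]; infer_instance) (by simpa [hW] using h')
      simpa [hW] using this
  rw [← valuation_Δ_aux_eq_of_isIntegral R W, ← valuation_Δ_aux_eq_of_isIntegral R (W.minimal R)]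
  exact h2

/-- Good reduction makes `j = c₄³ / Δ` integral. Both `c₄³` and `Δ` scale by `u⁻¹²`, so the
inequality passes from the minimal model to any model. -/
lemma valuation_c₄_pow_le_Δ_of_hasGoodReduction {W : WeierstrassCurve K}
    (h : (W.minimal R).HasGoodReduction R) :
    valuation K (maximalIdeal R) W.c₄ ^ 3 ≤ valuation K (maximalIdeal R) W.Δ := by
  obtain ⟨C, hC⟩ := W.exists_minimal_eq_smul R
  have h1 := h.goodReduction
  have h2 := valuation_c₄_le_one R (W.minimal R)
  rw [hC, variableChange_Δ, map_mul, map_pow] at h1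
  rw [hC, variableChange_c₄, map_mul, map_pow] at h2
  have h3 := pow_le_one' h2 3
  rw [mul_pow, ← pow_mul, ← h1] at h3
  refine le_of_mul_le_mul_left h3 (pow_pos (zero_lt_iff.2 ?_) _)
  simp

lemma valuation_Δ_lt_c₄_pow_of_hasMultiplicativeReduction {W : WeierstrassCurve K}
    (h : (W.minimal R).HasMultiplicativeReduction R) :
    valuation K (maximalIdeal R) W.Δ < valuation K (maximalIdeal R) W.c₄ ^ 3 := by
  obtain ⟨C, hC⟩ := W.exists_minimal_eq_smul R
  have h1 := h.badReduction
  have h2 := h.multiplicativeReduction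
  rw [hC, variableChange_Δ, map_mul, map_pow] at h1
  rw [hC, variableChange_c₄, map_mul, map_pow] at h2
  have h3 := congrArg (· ^ 3) h2
  simp only [one_pow, mul_pow, ← pow_mul] at h3
  rw [← h3] at h1
  exact lt_of_mul_lt_mul_left h1 zero_le

lemma hasGoodReduction_minimal {W : WeierstrassCurve K} [IsIntegral R W]
    (h : valuation K (maximalIdeal R) W.Δ = 1) : (W.minimal R).HasGoodReduction R :=
  { goodReduction :=
      le_antisymm (valuation_Δ_le_one R _) (h.ge.trans (W.valuation_Δ_le_minimal R)) }

/-- An integral model with unit `c₄` is already minimal: integrality of the new `c₄` bounds the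
valuation of `u⁻¹` above by `1`, and maximality of the new `Δ` bounds it below. -/
lemma hasMultiplicativeReduction_minimal {W : WeierstrassCurve K} [IsIntegral R W]
    (hΔ0 : W.Δ ≠ 0) (hΔ : valuation K (maximalIdeal R) W.Δ < 1)
    (hc₄ : valuation K (maximalIdeal R) W.c₄ = 1) :
    (W.minimal R).HasMultiplicativeReduction R := by
  obtain ⟨C, hC⟩ := W.exists_minimal_eq_smul R
  have h1 := valuation_c₄_le_one R (W.minimal R)
  have h2 := W.valuation_Δ_le_minimal R
  rw [hC, variableChange_c₄, map_mul, map_pow, hc₄, mul_one] at h1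
  rw [hC, variableChange_Δ, map_mul, map_pow] at h2
  have hu : valuation K (maximalIdeal R) (C.u⁻¹ : Kˣ) = 1 := by
    refine le_antisymm ((pow_le_one_iff (by norm_num)).1 h1) ?_
    rw [← one_le_pow_iff (n := 12) (by norm_num)]
    have h0 : valuation K (maximalIdeal R) W.Δ ≠ 0 := (Valuation.ne_zero_iff _).2 hΔ0
    exact le_of_mul_le_mul_right (by rwa [one_mul]) (zero_lt_iff.2 h0)
  exact
    { badReduction := by rwa [hC, variableChange_Δ, map_mul, map_pow, hu, one_pow, one_mul]
      multiplicativeReduction := by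
        rw [hC, variableChange_c₄, map_mul, map_pow, hu, one_pow, one_mul, hc₄] }

end Reduction

/-! ### Conductor exponents and valuations of integers -/

section Conductor

open IsDiscreteValuationRing IsDedekindDomain.HeightOneSpectrum

/-- Additive reduction thus has exponent at least `2`, so exponents `0` and `1` determine the
reduction type; nothing else about the wild part is needed. -/
lemma wildConductorExponent_nonneg (W : WeierstrassCurve ℚ) (p : ℕ) [Fact p.Prime] :
    0 ≤ W.wildConductorExponent p :=
  finsum_nonneg fun _ ↦ by positivity

lemma hasGoodReduction_of_conductorExponent_eq_zero {W : WeierstrassCurve ℚ} {p : ℕ}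
    [Fact p.Prime] (h : W.conductorExponent p = 0) :
    ((W.baseChange ℚ_[p]).minimal ℤ_[p]).HasGoodReduction ℤ_[p] := by
  have := W.wildConductorExponent_nonneg p
  by_contra hg
  simp only [conductorExponent, hg, if_false] at h
  split_ifs at h <;> linarith

lemma hasMultiplicativeReduction_of_conductorExponent_eq_one {W : WeierstrassCurve ℚ} {p : ℕ}
    [Fact p.Prime] (h : W.conductorExponent p = 1) :
    ((W.baseChange ℚ_[p]).minimal ℤ_[p]).HasMultiplicativeReduction ℤ_[p] := by
  have := W.wildConductorExponent_nonneg p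
  by_contra hg
  simp only [conductorExponent, hg, if_false] at h
  split_ifs at h <;> linarith

lemma conductorExponent_eq_zero {W : WeierstrassCurve ℚ} {p : ℕ} [Fact p.Prime]
    (h : ((W.baseChange ℚ_[p]).minimal ℤ_[p]).HasGoodReduction ℤ_[p]) :
    W.conductorExponent p = 0 := by
  simp [conductorExponent, h]

lemma conductorExponent_eq_one {W : WeierstrassCurve ℚ} {p : ℕ} [Fact p.Prime]
    (h : ((W.baseChange ℚ_[p]).minimal ℤ_[p]).HasMultiplicativeReduction ℤ_[p]) :
    W.conductorExponent p = 1 := by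
  simp [conductorExponent, h, h.not_hasGoodReduction]

lemma valuation_padic_intCast_le_one (p : ℕ) [Fact p.Prime] (n : ℤ) :
    valuation ℚ_[p] (maximalIdeal ℤ_[p]) (n : ℚ_[p]) ≤ 1 := by
  rw [← map_intCast (algebraMap ℤ_[p] ℚ_[p])]
  exact valuation_le_one _ _

lemma valuation_padic_intCast_lt_one_iff (p : ℕ) [Fact p.Prime] (n : ℤ) :
    valuation ℚ_[p] (maximalIdeal ℤ_[p]) (n : ℚ_[p]) < 1 ↔ (p : ℤ) ∣ n := by
  rw [← map_intCast (algebraMap ℤ_[p] ℚ_[p]), valuation_lt_one_iff_mem,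
    ← PadicInt.norm_intCast_lt_one_iff, ← PadicInt.mem_nonunits]
  rfl

lemma valuation_padic_intCast_eq_one_iff (p : ℕ) [Fact p.Prime] (n : ℤ) :
    valuation ℚ_[p] (maximalIdeal ℤ_[p]) (n : ℚ_[p]) = 1 ↔ ¬ (p : ℤ) ∣ n := by
  rw [← valuation_padic_intCast_lt_one_iff, not_lt]
  exact ⟨fun h ↦ h.ge, fun h ↦ le_antisymm (valuation_padic_intCast_le_one p n) h⟩

end Conductor

/-! ### Two-torsion and the roots of the 2-division cubic -/

lemma two_zsmul_some_eq_zero_iff {F : Type*} [Field F] [DecidableEq F] {W : Affine F} {x y : F}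
    (h : W.Nonsingular x y) : (2 : ℤ) • Affine.Point.some x y h = 0 ↔
      2 * y + W.a₁ * x + W.a₃ = 0 := by
  rw [two_zsmul, add_eq_zero_iff_eq_neg, Affine.Point.neg_some, Affine.Point.some.injEq]
  simp only [true_and, Affine.negY]
  constructor <;> intro h <;> linear_combination h

lemma hasFullTwoTorsion_iff_card {W : WeierstrassCurve ℚ} :
    W.HasFullTwoTorsion ↔ Nat.card (AddSubgroup.torsionBy W.toAffine.Point 2) = 4 := by
  constructor
  · rintro ⟨e⟩
    rw [Nat.card_congr e.toEquiv, IsAddKleinFour.card_four]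
  · intro h
    have : IsAddKleinFour (AddSubgroup.torsionBy W.toAffine.Point 2) :=
      { card_four := h
        exponent_two := by
          have h2 : AddMonoid.exponent (AddSubgroup.torsionBy W.toAffine.Point 2) ∣ 2 := by
            refine AddMonoid.exponent_dvd_of_forall_nsmul_eq_zero fun P ↦ ?_
            have h2 : (2 : ℤ) • (P : W.toAffine.Point) = 0 := (Submodule.mem_torsionBy_iff _ _).1 P.2
            ext
            rwa [AddSubgroup.coe_nsmul, ← natCast_zsmul]
          refine ((Nat.dvd_prime Nat.prime_two).1 h2).resolve_left fun h1 ↦ ?_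
          have := AddMonoid.exp_eq_one_iff.1 h1
          have := Nat.card_of_subsingleton (0 : AddSubgroup.torsionBy W.toAffine.Point 2)
          omega }
    exact IsAddKleinFour.nonempty_addEquiv

lemma HasFullTwoTorsion.exists_roots {W : WeierstrassCurve ℚ} (h : W.HasFullTwoTorsion) :
    ∃ x y z : ℚ, x ≠ y ∧ y ≠ z ∧ x ≠ z ∧
      ∀ t ∈ ({x, y, z} : Set ℚ), 4 * t ^ 3 + W.b₂ * t ^ 2 + 2 * W.b₄ * t + W.b₆ = 0 := by
  obtain ⟨e⟩ := h
  have key : ∀ a : ZMod 2 × ZMod 2, a ≠ 0 → ∃ (x y : ℚ) (hxy : W.toAffine.Nonsingular x y),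
      (e.symm a : W.toAffine.Point) = .some x y hxy ∧ 2 * y + W.a₁ * x + W.a₃ = 0 := by
    intro a ha
    have hne : (e.symm a : W.toAffine.Point) ≠ 0 := by
      rwa [ne_eq, ZeroMemClass.coe_eq_zero, EmbeddingLike.map_eq_zero_iff]
    have h2 : (2 : ℤ) • (e.symm a : W.toAffine.Point) = 0 :=
      (Submodule.mem_torsionBy_iff _ _).1 (e.symm a).2
    rcases hP : (e.symm a : W.toAffine.Point) with _ | ⟨x, y, hxy⟩
    · exact absurd hP hne
    · rw [hP, two_zsmul_some_eq_zero_iff] at h2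
      exact ⟨x, y, hxy, rfl, h2⟩
  -- On 2-torsion points `y` is determined by `x`, so distinct points have distinct `x`.
  have hinj : ∀ {a b : ZMod 2 × ZMod 2} {x y x' y' : ℚ} {h : W.toAffine.Nonsingular x y}
      {h' : W.toAffine.Nonsingular x' y'}, a ≠ b →
      (e.symm a : W.toAffine.Point) = .some x y h → 2 * y + W.a₁ * x + W.a₃ = 0 →
      (e.symm b : W.toAffine.Point) = .some x' y' h' → 2 * y' + W.a₁ * x' + W.a₃ = 0 →
      x ≠ x' := by
    rintro a b x y x' y' h h' hab ha hy hb hy' rfl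
    obtain rfl : y = y' := by linarith
    exact hab (e.symm.injective (Subtype.ext (ha.trans hb.symm)))
  have hroot : ∀ {x y : ℚ}, W.toAffine.Nonsingular x y → 2 * y + W.a₁ * x + W.a₃ = 0 →
      4 * x ^ 3 + W.b₂ * x ^ 2 + 2 * W.b₄ * x + W.b₆ = 0 := by
    intro x y h hy
    have := (Affine.equation_iff _ _).1 h.1
    simp only [b₂, b₄, b₆]
    linear_combination (2 * y + W.a₁ * x + W.a₃) * hy - 4 * this
  obtain ⟨x₁, y₁, h₁, e₁, t₁⟩ := key (1, 0) (by decide)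
  obtain ⟨x₂, y₂, h₂, e₂, t₂⟩ := key (0, 1) (by decide)
  obtain ⟨x₃, y₃, h₃, e₃, t₃⟩ := key (1, 1) (by decide)
  refine ⟨x₁, x₂, x₃, hinj (by decide) e₁ t₁ e₂ t₂, hinj (by decide) e₂ t₂ e₃ t₃,
    hinj (by decide) e₁ t₁ e₃ t₃, ?_⟩
  rintro t (rfl | rfl | rfl)
  exacts [hroot h₁ t₁, hroot h₂ t₂, hroot h₃ t₃]

lemma c₄_Δ_eq_of_roots {F : Type*} [Field F] [CharZero F] {W : WeierstrassCurve F} {x y z : F}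
    (hxy : x ≠ y) (hyz : y ≠ z) (hxz : x ≠ z)
    (h : ∀ t ∈ ({x, y, z} : Set F), 4 * t ^ 3 + W.b₂ * t ^ 2 + 2 * W.b₄ * t + W.b₆ = 0) :
    W.c₄ = 16 * ((x - y) ^ 2 + (x - y) * (y - z) + (y - z) ^ 2) ∧
      W.Δ = 16 * ((x - y) * (y - z) * ((x - y) + (y - z))) ^ 2 := by
  have hx := h x (by simp)
  have hy := h y (by simp)
  have hz := h z (by simp)
  -- Divided differences of the cubic recover Vieta's formulas for `b₂`, `b₄`, `b₆`.
  have e1 : 4 * (x ^ 2 + x * y + y ^ 2) + W.b₂ * (x + y) + 2 * W.b₄ = 0 :=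
    mul_left_cancel₀ (sub_ne_zero.2 hxy) (by linear_combination hx - hy)
  have e2 : 4 * (y ^ 2 + y * z + z ^ 2) + W.b₂ * (y + z) + 2 * W.b₄ = 0 :=
    mul_left_cancel₀ (sub_ne_zero.2 hyz) (by linear_combination hy - hz)
  have hb2 : W.b₂ = -4 * (x + y + z) :=
    mul_left_cancel₀ (sub_ne_zero.2 hxz) (by linear_combination e1 - e2)
  have hb4 : W.b₄ = 2 * (x * y + y * z + z * x) :=
    mul_left_cancel₀ (two_ne_zero (α := F)) (by linear_combination e1 - (x + y) * hb2)
  have hb6 : W.b₆ = -4 * (x * y * z) := by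
    linear_combination hx - x ^ 2 * hb2 - 2 * x * hb4
  have hb8 : 4 * W.b₈ = W.b₂ * W.b₆ - W.b₄ ^ 2 := W.b_relation
  constructor
  · rw [c₄, hb2, hb4]; ring
  · refine mul_left_cancel₀ (by norm_num : (4 : F) ≠ 0) ?_
    have : 4 * W.Δ = - W.b₂ ^ 2 * (4 * W.b₈) - 32 * W.b₄ ^ 3 - 108 * W.b₆ ^ 2
        + 36 * W.b₂ * W.b₄ * W.b₆ := by rw [Δ]; ring
    rw [this, hb8, hb2, hb4, hb6]
    ring

lemma exists_coprime_int_smul {a b : ℚ} (ha : a ≠ 0) :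
    ∃ (A B : ℤ) (l : ℚ), IsCoprime A B ∧ a = l * A ∧ b = l * B := by
  have ha' : a.num * b.den ≠ 0 := by simp [ha]
  obtain ⟨g, A, B, hg, hAB, h1, h2⟩ :=
    Int.exists_gcd_one' (m := a.num * b.den) (n := b.num * a.den) (Int.gcd_pos_of_ne_zero_left _ ha')
  refine ⟨A, B, g / (a.den * b.den), Int.isCoprime_iff_gcd_eq_one.2 hAB, ?_, ?_⟩
  · have h1' : (a.num : ℚ) * b.den = A * g := by exact_mod_cast h1
    have := Rat.num_div_den a
    field_simp
    nth_rewrite 1 [← Rat.num_div_den a]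
    field_simp
    linear_combination h1'
  · have h1' : (b.num : ℚ) * a.den = B * g := by exact_mod_cast h2
    nth_rewrite 1 [← Rat.num_div_den b]
    field_simp
    linear_combination h1'

/-! ### An explicit semistable family -/

/-- The curve `Y² + XY = X³ + 4sX² + sX`. -/
def twoTorsionFamily (s : ℤ) : WeierstrassCurve ℤ := ⟨1, 4 * s, 0, s, 0⟩

lemma twoTorsionFamily_Δ (s : ℤ) : (twoTorsionFamily s).Δ = (s * (16 * s - 1)) ^ 2 := by
  simp only [twoTorsionFamily, Δ, b₂, b₄, b₆, b₈]
  ring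

/-- Since `c₄` is `1` modulo `s(16s - 1)`, it is coprime to `Δ`, so every bad prime is
multiplicative. -/
lemma twoTorsionFamily_c₄ (s : ℤ) : (twoTorsionFamily s).c₄ = 16 * s * (16 * s - 1) + 1 := by
  simp only [twoTorsionFamily, c₄, b₂, b₄]
  ring

lemma twoTorsionFamily_hasFullTwoTorsion {s : ℤ} (hs : s ≠ 0) :
    ((twoTorsionFamily s).baseChange ℚ).HasFullTwoTorsion := by
  set W := (twoTorsionFamily s).baseChange ℚ with hW
  have h16 : (16 * s - 1 : ℚ) ≠ 0 := by
    have : (16 * s - 1 : ℤ) ≠ 0 := by omega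
    exact_mod_cast this
  have hs' : (s : ℚ) ≠ 0 := by exact_mod_cast hs
  have hΔ : W.Δ ≠ 0 := by
    rw [hW, baseChange, map_Δ, twoTorsionFamily_Δ]
    simp [hs', h16]
  have ha₁ : W.a₁ = 1 := by simp [hW, baseChange, twoTorsionFamily]
  have ha₂ : W.a₂ = 4 * s := by simp [hW, baseChange, twoTorsionFamily]
  have ha₃ : W.a₃ = 0 := by simp [hW, baseChange, twoTorsionFamily]
  have ha₄ : W.a₄ = s := by simp [hW, baseChange, twoTorsionFamily]
  have ha₆ : W.a₆ = 0 := by simp [hW, baseChange, twoTorsionFamily]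
  have hns : ∀ {x y : ℚ}, y ^ 2 + x * y = x ^ 3 + 4 * s * x ^ 2 + s * x →
      W.toAffine.Nonsingular x y := fun {x y} h ↦
    (Affine.equation_iff_nonsingular_of_Δ_ne_zero hΔ).1 <| by
      rw [Affine.equation_iff, ha₁, ha₂, ha₃, ha₄, ha₆]
      linear_combination h
  -- With `y = -x/2` the equation becomes `x(x + 1/4)(x + 4s) = 0`.
  have h₁ := hns (x := 0) (y := 0) (by ring)
  have h₂ := hns (x := -1 / 4) (y := 1 / 8) (by ring)
  have h₃ := hns (x := -4 * s) (y := 2 * s) (by ring)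
  have hset : (AddSubgroup.torsionBy W.toAffine.Point 2 : Set W.toAffine.Point) =
      {0, .some _ _ h₁, .some _ _ h₂, .some _ _ h₃} := by
    ext P
    have : P ∈ (AddSubgroup.torsionBy W.toAffine.Point 2 : Set W.toAffine.Point) ↔
        (2 : ℤ) • P = 0 := Submodule.mem_torsionBy_iff _ _
    rw [this]
    rcases P with _ | ⟨x, y, h⟩
    · simp only [← Affine.Point.zero_def, Set.mem_insert_iff, true_or, iff_true]
      exact zsmul_zero _
    · rw [two_zsmul_some_eq_zero_iff, ha₁, ha₃]
      simp only [Set.mem_insert_iff, Set.mem_singleton_iff, Affine.Point.some_ne_zero, false_or,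
        Affine.Point.some.injEq]
      constructor
      · intro h2
        have h3 := (Affine.equation_iff _ _).1 h.1
        rw [ha₁, ha₂, ha₃, ha₄, ha₆] at h3
        have hy : y = -x / 2 := by linarith
        have h4 : x * ((x - -1 / 4) * (x - -4 * s)) = 0 := by
          rw [hy] at h3
          linear_combination -h3
        rcases mul_eq_zero.1 h4 with h5 | h5
        · left; constructor <;> linarith
        rcases mul_eq_zero.1 h5 with h5 | h5
        · right; left; constructor <;> linarith
        · right; right; constructor <;> linarith
      · rintro (⟨rfl, rfl⟩ | ⟨rfl, rfl⟩ | ⟨rfl, rfl⟩) <;> ring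
  rw [hasFullTwoTorsion_iff_card]
  change Nat.card (AddSubgroup.torsionBy W.toAffine.Point 2 : Set W.toAffine.Point) = 4
  rw [hset, Nat.card_coe_set_eq]
  have h23 : (-1 / 4 : ℚ) ≠ -4 * s := fun h ↦ h16 (by linarith)
  rw [Set.ncard_insert_of_notMem, Set.ncard_insert_of_notMem, Set.ncard_pair]
  · simp only [ne_eq, Affine.Point.some.injEq, h23, false_and, not_false_eq_true]
  · simp [hs', Affine.Point.some.injEq]
  · simp [eq_comm (a := (0 : W.toAffine.Point)), Affine.Point.some_ne_zero]

open IsDiscreteValuationRing IsDedekindDomain.HeightOneSpectrum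

lemma baseChange_isIntegral_padic (W : WeierstrassCurve ℤ) (p : ℕ) [Fact p.Prime] :
    IsIntegral ℤ_[p] ((W.baseChange ℚ).baseChange ℚ_[p]) := by
  apply isIntegral_of_exists_lift
  · exact ⟨W.a₁, by simp [baseChange]⟩
  · exact ⟨W.a₂, by simp [baseChange]⟩
  · exact ⟨W.a₃, by simp [baseChange]⟩
  · exact ⟨W.a₄, by simp [baseChange]⟩
  · exact ⟨W.a₆, by simp [baseChange]⟩

lemma conductorExponent_of_not_dvd_Δ {W : WeierstrassCurve ℤ} {p : ℕ} [Fact p.Prime]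
    (h : ¬ (p : ℤ) ∣ W.Δ) : (W.baseChange ℚ).conductorExponent p = 0 := by
  have := W.baseChange_isIntegral_padic p
  refine conductorExponent_eq_zero (hasGoodReduction_minimal _ ?_)
  have e : ((W.baseChange ℚ).baseChange ℚ_[p]).Δ = (W.Δ : ℚ_[p]) := by simp [baseChange, map_Δ]
  rw [e, valuation_padic_intCast_eq_one_iff]
  exact h

lemma conductorExponent_of_dvd_Δ {W : WeierstrassCurve ℤ} {p : ℕ} [Fact p.Prime]
    (h0 : W.Δ ≠ 0) (h : (p : ℤ) ∣ W.Δ) (hc : ¬ (p : ℤ) ∣ W.c₄) :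
    (W.baseChange ℚ).conductorExponent p = 1 := by
  have := W.baseChange_isIntegral_padic p
  have e : ((W.baseChange ℚ).baseChange ℚ_[p]).Δ = (W.Δ : ℚ_[p]) := by simp [baseChange, map_Δ]
  have e' : ((W.baseChange ℚ).baseChange ℚ_[p]).c₄ = (W.c₄ : ℚ_[p]) := by
    simp [baseChange, map_c₄]
  refine conductorExponent_eq_one (hasMultiplicativeReduction_minimal _ ?_ ?_ ?_)
  · rw [e]
    exact_mod_cast h0
  · rwa [e, valuation_padic_intCast_lt_one_iff]
  · rwa [e', valuation_padic_intCast_eq_one_iff]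

lemma padicValNat_two_mul_prime {L p : ℕ} (hL : L.Prime) (hL2 : L ≠ 2) (hp : p.Prime) :
    padicValNat p (2 * L) = if p = 2 ∨ p = L then 1 else 0 := by
  have := Fact.mk hp
  have := Fact.mk hL
  have := Nat.fact_prime_two
  rw [padicValNat.mul two_ne_zero hL.ne_zero]
  by_cases h2 : p = 2
  · subst h2
    simp [padicValNat_primes hL2.symm]
  · by_cases h : p = L
    · subst h
      simp [padicValNat_primes h2]
    · simp [h2, h, padicValNat_primes h2, padicValNat_primes h]

lemma twoTorsionFamily_isConductor {L k : ℕ} (hL : L.Prime) (hL2 : L ≠ 2) {s : ℤ}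
    (hs : s.natAbs = 2 ^ (k + 1)) (hsL : (16 * s - 1).natAbs = L) :
    ((twoTorsionFamily s).baseChange ℚ).IsElliptic ∧
      ((twoTorsionFamily s).baseChange ℚ).HasFullTwoTorsion ∧
      ((twoTorsionFamily s).baseChange ℚ).IsConductor (2 * L) := by
  have hs0 : s ≠ 0 := by
    rintro rfl
    exact (Nat.two_pow_pos (k + 1)).ne hs
  have h0 : (twoTorsionFamily s).Δ ≠ 0 := by
    rw [twoTorsionFamily_Δ]
    exact pow_ne_zero _ (mul_ne_zero hs0 (by omega))
  have hdvd : ∀ p : ℕ, p.Prime → ((p : ℤ) ∣ s * (16 * s - 1) ↔ p = 2 ∨ p = L) := by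
    intro p hp
    rw [(Nat.prime_iff_prime_int.1 hp).dvd_mul, Int.natCast_dvd, Int.natCast_dvd, hs, hsL,
      (Nat.prime_iff.1 hp).dvd_pow_iff_dvd k.succ_ne_zero,
      Nat.prime_dvd_prime_iff_eq hp Nat.prime_two, Nat.prime_dvd_prime_iff_eq hp hL]
  refine ⟨?_, twoTorsionFamily_hasFullTwoTorsion hs0, by have := hL.pos; omega, fun p hp ↦ ?_⟩
  · rw [isElliptic_iff, baseChange, map_Δ, isUnit_iff_ne_zero]
    simpa using h0
  · have hpp := Nat.prime_iff_prime_int.1 hp.out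
    rw [padicValNat_two_mul_prime hL hL2 hp.out]
    by_cases h : p = 2 ∨ p = L
    · have hd := (hdvd p hp.out).2 h
      rw [if_pos h, conductorExponent_of_dvd_Δ h0]
      · simp
      · rw [twoTorsionFamily_Δ]
        exact dvd_pow hd two_ne_zero
      · rw [twoTorsionFamily_c₄, mul_assoc, Int.dvd_add_right (hd.mul_left 16)]
        exact hpp.not_dvd_one
    · rw [if_neg h, conductorExponent_of_not_dvd_Δ]
      · simp
      · rw [twoTorsionFamily_Δ]
        exact fun hd ↦ h ((hdvd p hp.out).1 (hpp.dvd_of_dvd_pow hd))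

/-! ### From the conductor to the Diophantine equation -/

/-- Up to scaling, the invariants of a curve with full `2`-torsion are `16 (a² + ab + b²)` and
`16 (ab(a + b))²` for some coprime integers `a` and `b`. -/
lemma HasFullTwoTorsion.exists_isCoprime {W : WeierstrassCurve ℚ} (h : W.HasFullTwoTorsion) :
    ∃ (a b : ℤ) (l : ℚ), l ≠ 0 ∧ IsCoprime a b ∧ a * b * (a + b) ≠ 0 ∧
      W.c₄ = l ^ 2 * (16 * (a ^ 2 + a * b + b ^ 2) : ℤ) ∧
      W.Δ = l ^ 6 * (16 * (a * b * (a + b)) ^ 2 : ℤ) := by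
  obtain ⟨x, y, z, hxy, hyz, hxz, hroots⟩ := h.exists_roots
  obtain ⟨hc, hΔ⟩ := c₄_Δ_eq_of_roots hxy hyz hxz hroots
  obtain ⟨a, b, l, hab, ha, hb⟩ := exists_coprime_int_smul (b := y - z) (sub_ne_zero.2 hxy)
  have h1 : x - y ≠ 0 := sub_ne_zero.2 hxy
  have h2 : y - z ≠ 0 := sub_ne_zero.2 hyz
  have h3 : (x - y) + (y - z) ≠ 0 := by
    rw [sub_add_sub_cancel]
    exact sub_ne_zero.2 hxz
  rw [ha, hb] at hc hΔ h3
  rw [ha] at h1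
  rw [hb] at h2
  have hl : l ≠ 0 := left_ne_zero_of_mul h1
  rw [← mul_add] at h3
  refine ⟨a, b, l, hl, hab, ?_, ?_, ?_⟩
  · exact mul_ne_zero (mul_ne_zero (by simpa [hl] using h1) (by simpa [hl] using h2))
      (by exact_mod_cast right_ne_zero_of_mul h3)
  · rw [hc]; push_cast; ring
  · rw [hΔ]; push_cast; ring

section Valuation

variable {W : WeierstrassCurve ℚ} {l : ℚ} (p : ℕ) [Fact p.Prime]

/-- The common factor `16 l⁶` of `c₄³` and `Δ` cancels, leaving `16² N³` against `P²`. -/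
lemma valuation_c₄_pow_le_iff (hl : l ≠ 0) {N P : ℤ} (hc : W.c₄ = l ^ 2 * (16 * N : ℤ))
    (hΔ : W.Δ = l ^ 6 * (16 * P ^ 2 : ℤ)) :
    valuation ℚ_[p] (maximalIdeal ℤ_[p]) (W.baseChange ℚ_[p]).c₄ ^ 3 ≤
        valuation ℚ_[p] (maximalIdeal ℤ_[p]) (W.baseChange ℚ_[p]).Δ ↔
      valuation ℚ_[p] (maximalIdeal ℤ_[p]) ((16 : ℤ) : ℚ_[p]) ^ 2 *
        valuation ℚ_[p] (maximalIdeal ℤ_[p]) (N : ℚ_[p]) ^ 3 ≤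
          valuation ℚ_[p] (maximalIdeal ℤ_[p]) (P : ℚ_[p]) ^ 2 := by
  set v := valuation ℚ_[p] (maximalIdeal ℤ_[p])
  have e : (W.baseChange ℚ_[p]).c₄ ^ 3 = (((l ^ 6 : ℚ) : ℚ_[p]) * ((16 : ℤ) : ℚ_[p])) *
      (((16 : ℤ) : ℚ_[p]) ^ 2 * (N : ℚ_[p]) ^ 3) := by
    rw [baseChange, map_c₄, hc]
    simp
    ring
  have e' : (W.baseChange ℚ_[p]).Δ = (((l ^ 6 : ℚ) : ℚ_[p]) * ((16 : ℤ) : ℚ_[p])) *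
      (P : ℚ_[p]) ^ 2 := by
    rw [baseChange, map_Δ, hΔ]
    simp
    ring
  have h0 : v (((l ^ 6 : ℚ) : ℚ_[p]) * ((16 : ℤ) : ℚ_[p])) ≠ 0 := by
    rw [Valuation.ne_zero_iff]
    simp [hl]
  rw [← map_pow, e, e', map_mul, map_mul v (_ * _) (_ ^ 2),
    mul_le_mul_iff_right₀ (zero_lt_iff.2 h0), map_mul, map_pow,
    map_pow, map_pow]

end Valuation

lemma two_pow_dvd_of_valuation_lt {n : ℤ} {k : ℕ} (hn : n ≠ 0)
    (h : valuation ℚ_[2] (maximalIdeal ℤ_[2]) (n : ℚ_[2]) <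
      valuation ℚ_[2] (maximalIdeal ℤ_[2]) ((2 ^ k : ℤ) : ℚ_[2])) : 2 ^ (k + 1) ∣ n := by
  obtain ⟨m, hm, hm'⟩ := (Int.finiteMultiplicity_iff (a := 2) (b := n)).2
    ⟨by norm_num, hn⟩ |>.exists_eq_pow_mul_and_not_dvd
  generalize multiplicity 2 n = i at hm
  subst hm
  have hm1 := (valuation_padic_intCast_eq_one_iff 2 m).2 hm'
  rw [Int.cast_mul, map_mul, hm1, mul_one, Int.cast_pow, Int.cast_pow, map_pow, map_pow] at h
  refine (pow_dvd_pow 2 ?_).mul_right m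
  by_contra! hik
  exact h.not_ge (pow_le_pow_right_of_le_one' (valuation_padic_intCast_le_one 2 2) (by omega))

lemma exists_two_pow_of_isConductor {L : ℕ} (hL : L.Prime) (hL2 : L ≠ 2) {W : WeierstrassCurve ℚ}
    (h2 : W.HasFullTwoTorsion) (hW : W.IsConductor (2 * L)) :
    ∃ k, 5 ≤ k ∧ (L + 1 = 2 ^ k ∨ L = 2 ^ k + 1) := by
  obtain ⟨a, b, l, hl, hab, h0, hc, hΔ⟩ := h2.exists_isCoprime
  -- Non-integrality of `j` gives `|P|² < |16|² |N|³`, and `|N| ≤ 1`.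
  have hone : ∀ (p : ℕ) [Fact p.Prime], p = 2 ∨ p = L →
      valuation ℚ_[p] (maximalIdeal ℤ_[p]) ((a * b * (a + b) : ℤ) : ℚ_[p]) ^ 2 <
        valuation ℚ_[p] (maximalIdeal ℤ_[p]) ((16 : ℤ) : ℚ_[p]) ^ 2 := by
    intro p hp h
    have he : W.conductorExponent p = 1 := by
      rw [← hW.2 p, padicValNat_two_mul_prime hL hL2 hp.out, if_pos h, Nat.cast_one]
    have hlt := valuation_Δ_lt_c₄_pow_of_hasMultiplicativeReduction _
      (hasMultiplicativeReduction_of_conductorExponent_eq_one he)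
    rw [← not_le, valuation_c₄_pow_le_iff p hl hc hΔ, not_le] at hlt
    exact hlt.trans_le (mul_le_of_le_one_right'
      (pow_le_one' (valuation_padic_intCast_le_one p _) 3))
  refine Int.exists_two_pow_of_isCoprime hL hL2 hab h0 (fun q hq hd ↦ ?_) ?_ ?_
  · by_contra hqL
    have := Fact.mk hq
    have hqp := Nat.prime_iff_prime_int.1 hq
    have he : W.conductorExponent q = 0 := by
      rw [← hW.2 q, padicValNat_two_mul_prime hL hL2 hq, if_neg hqL, Nat.cast_zero]
    have hle := valuation_c₄_pow_le_Δ_of_hasGoodReduction _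
      (hasGoodReduction_of_conductorExponent_eq_zero he)
    have h16 : ¬ (q : ℤ) ∣ 16 := fun h ↦ hqL <| Or.inl <|
      (Nat.prime_dvd_prime_iff_eq hq Nat.prime_two).1 <| hq.dvd_of_dvd_pow (n := 4)
        (by exact_mod_cast h)
    rw [valuation_c₄_pow_le_iff q hl hc hΔ, (valuation_padic_intCast_eq_one_iff q 16).2 h16,
      one_pow, one_mul] at hle
    -- Modulo any of `a`, `b`, `a + b`, the form `N` is a square of `a` or `b`, so a common prime
    -- factor of `N` and `P` would divide both `a` and `b`.
    have hN : ¬ (q : ℤ) ∣ a ^ 2 + a * b + b ^ 2 := by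
      intro hN
      have key : (q : ℤ) ∣ a ∧ (q : ℤ) ∣ b := by
        rcases hqp.dvd_or_dvd hd with h | h
        · rcases hqp.dvd_or_dvd h with h | h
          · refine ⟨h, hqp.dvd_of_dvd_pow (n := 2) ?_⟩
            have e : b ^ 2 = (a ^ 2 + a * b + b ^ 2) - a * (a + b) := by ring
            exact e ▸ dvd_sub hN (h.mul_right _)
          · refine ⟨hqp.dvd_of_dvd_pow (n := 2) ?_, h⟩
            have e : a ^ 2 = (a ^ 2 + a * b + b ^ 2) - b * (a + b) := by ring
            exact e ▸ dvd_sub hN (h.mul_right _)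
        · have ha : (q : ℤ) ∣ a := hqp.dvd_of_dvd_pow (n := 2) (by
            have e : a ^ 2 = (a ^ 2 + a * b + b ^ 2) - (a + b) * b := by ring
            exact e ▸ dvd_sub hN (h.mul_right _))
          exact ⟨ha, (dvd_add_right ha).1 h⟩
      exact hqp.not_isUnit (hab.isUnit_of_dvd' key.1 key.2)
    rw [(valuation_padic_intCast_eq_one_iff q _).2 hN, one_pow] at hle
    exact hle.not_gt (pow_lt_one₀ zero_le ((valuation_padic_intCast_lt_one_iff q _).2 hd)
      two_ne_zero)
  · have := Fact.mk hL
    rw [← valuation_padic_intCast_lt_one_iff L]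
    exact (lt_of_pow_lt_pow_left' 2 (hone L (Or.inr rfl))).trans_le
      (valuation_padic_intCast_le_one L _)
  · have := lt_of_pow_lt_pow_left' 2 (hone 2 (Or.inl rfl))
    -- The strict inequality `|P| < |16|` at `2` gains one more factor: `32 ∣ P`.
    exact two_pow_dvd_of_valuation_lt (k := 4) h0 (by norm_num at this ⊢; exact this)

end WeierstrassCurve

/-! ### The classification -/

open WeierstrassCurve in
theorem mainTheorem3 (L : ℕ) (hL : L.Prime) (hodd : Odd L) :
    (∃ E : WeierstrassCurve ℚ, E.IsElliptic ∧ E.HasFullTwoTorsion ∧ E.IsConductor (2 * L)) ↔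
      ((∃ n : ℕ, L = mersenne n) ∨ (∃ n : ℕ, L = Nat.fermatNumber n)) ∧ 31 ≤ L := by
  have hL2 : L ≠ 2 := by
    rintro rfl
    exact absurd hodd (by decide)
  constructor
  · rintro ⟨E, -, h2, hE⟩
    obtain ⟨k, hk, h⟩ := exists_two_pow_of_isConductor hL hL2 h2 hE
    have hk32 : 32 ≤ 2 ^ k := Nat.pow_le_pow_right (n := 2) (by norm_num) hk
    refine ⟨?_, by omega⟩
    rcases h with h | h
    · exact Or.inl ⟨k, by rw [mersenne]; omega⟩
    · obtain ⟨n, rfl⟩ := Nat.pow_of_pow_add_prime (n := k) one_lt_two (by omega) (h ▸ hL)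
      exact Or.inr ⟨n, h⟩
  · rintro ⟨h, h31⟩
    have key : ∃ k, L + 1 = 2 ^ k ∨ L = 2 ^ k + 1 := by
      rcases h with ⟨n, rfl⟩ | ⟨n, rfl⟩
      · exact ⟨n, Or.inl (succ_mersenne n)⟩
      · exact ⟨2 ^ n, Or.inr rfl⟩
    obtain ⟨k, hk⟩ := key
    -- For `k ≤ 4` both forms give `L ≤ 17`.
    obtain ⟨j, rfl⟩ : ∃ j, k = j + 5 := by
      refine ⟨k - 5, ?_⟩
      by_contra hk5
      have : 2 ^ k ≤ 2 ^ 4 := Nat.pow_le_pow_right (by norm_num) (by omega)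
      omega
    have hpow : 2 ^ (j + 5) = 16 * 2 ^ (j + 1) := by ring
    rw [hpow] at hk
    -- The sign of `s` selects the case: `16s - 1` is `2 ^ (j + 5) - 1` or `-(2 ^ (j + 5) + 1)`.
    rcases hk with hk | hk
    · exact ⟨_, twoTorsionFamily_isConductor hL hL2 (s := (2 ^ (j + 1) : ℕ)) (k := j)
        (by simp) (by omega)⟩
    · exact ⟨_, twoTorsionFamily_isConductor hL hL2 (s := -(2 ^ (j + 1) : ℕ)) (k := j)
        (by simp) (by omega)⟩
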